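/- Let $K$ be an arbitrary field and let $n \geq 0$ be an integer. A matrix $M \in M_n(K)$ is alternating if $X^T M X = 0$ for all $X \in K^n$; let $A_n(K)$ denote the space of all alternating $n \times n$ matrices over $K$. Let $S$ be a $K$-linear subspace of $A_n(K)$ and let $\operatorname{codim} S$ denote its codimension in $A_n(K)$. A map $F : S \to K^n$ is range-compatible if, for every $M \in S$, the vector $F(M)$ belongs to the range $\{MX : X \in K^n\}$ of $M$; it is local if there is a vector $x \in K^n$ such that $F(M) = Mx$ for all $M \in S$. (a) If $\operatorname{codim} S \leq n-3$, then every range-compatible group homomorphism $F : (S,+) \to (K^n,+)$ is local. (b) The bound $n-3$ is optimal in the following sense: if $K$ is not a prime field (that is, $K$ has a proper subfield) and $n \geq 2$, then there exist a linear subspace $S$ of $A_n(K)$ with $\operatorname{codim} S = n-2$ and a range-compatible group homomorphism $F : (S,+) \to (K^n,+)$ that is not local. -/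

import Mathlib

open Matrix

/-- The space `A_n(K)` of alternating `n × n` matrices: those `M` with `Xᵀ M X = 0` for all
`X ∈ Kⁿ`. -/
def altMatrices (n : ℕ) (K : Type*) [Field K] : Submodule K (Matrix (Fin n) (Fin n) K) where
  carrier := {M | ∀ X : Fin n → K, X ⬝ᵥ (M *ᵥ X) = 0}
  add_mem' := by
    intro M N hM hN X
    rw [Matrix.add_mulVec, dotProduct_add, hM X, hN X, add_zero]
  zero_mem' := by
    intro X
    simp
  smul_mem' := by
    intro c M hM X
    rw [Matrix.smul_mulVec, dotProduct_smul, hM X, smul_zero]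

/-- The codimension of `S` in `A` (meant for `S ≤ A`), i.e. the dimension of `A ⧸ S`. -/
noncomputable def codimIn {K E : Type*} [Field K] [AddCommGroup E] [Module K E]
    (S A : Submodule K E) : ℕ :=
  Module.finrank K (A ⧸ S.submoduleOf A)

/-- A map `F` on a space `S` of matrices with `n` rows and `p` columns, regarded as linear maps
`X ↦ M X` from `Kᵖ` to `Kⁿ`, is range-compatible if `F M` lies in the range of `M` for all
`M ∈ S`. -/
def RangeCompatible {n p : ℕ} {K : Type*} [Field K]
    {S : Submodule K (Matrix (Fin n) (Fin p) K)} (F : S → (Fin n → K)) : Prop :=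
  ∀ M : S, F M ∈ LinearMap.range (M : Matrix (Fin n) (Fin p) K).mulVecLin

/-- A map `F` on a space `S` of matrices is local if there is a single vector `x` such that
`F M = M x` for all `M ∈ S`. -/
def LocalMap {n p : ℕ} {K : Type*} [Field K]
    {S : Submodule K (Matrix (Fin n) (Fin p) K)} (F : S → (Fin n → K)) : Prop :=
  ∃ x : Fin p → K, ∀ M : S, F M = (M : Matrix (Fin n) (Fin p) K) *ᵥ x

/-! The range of an alternating matrix is orthogonal to its kernel, so for a range-compatible
homomorphism F the scalar F(M)·x depends only on Mx. This is exploited at ordinary vectors z and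
ordinary pairs (x, z), where Mz, respectively (Mx, Mz), takes on S every value that alternation
permits. Testing at z + cx links F(cM)·z with F(N)·x, which yields linearity. Then F(M)·z = u·Mz,
where u varies with z in a controlled way; adding a local map makes F orthogonal to both x and z,
and such a map is zero.

Ordinary vectors exist by a dimension count. The forms M ↦ xᵀMy on A_n(K) behave like wedges x ∧ y,
and the annihilator L of S has dimension codim S. If z is not ordinary, L contains some z ∧ b with b
outside Kz. By `finrank_le_of_covered`, this cannot happen on a whole affine space whose dimension
exceeds dim L. An affine hyperplane, of dimension n - 1, therefore contains an ordinary vector z.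
Working modulo z, an affine space of dimension at least n - 2 avoiding any given hyperplane through
z contains an ordinary partner of z, so z and its partners span Kⁿ. The second count is the one that
needs codim S ≤ n - 3.

For optimality, kill all entries of the first row but M₀₁. The first column is then a multiple of
e₁, and M ↦ f(M₀₁)e₁ is range-compatible for every additive f, but local only if f is a homothety.
-/

/-! ### Wedge products modulo a subspace, and covered vectors. -/

section Wedge

variable {K U X : Type*} [Field K] [AddCommGroup U] [Module K U] [AddCommGroup X] [Module K X]

/-- A bilinear map that behaves like the wedge product `(x, y) ↦ x ∧ y` of `U ⧸ R`. -/
structure WedgeLike (R : Submodule K U) (w : U →ₗ[K] U →ₗ[K] X) : Prop where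
  alt : w.IsAlt
  rad : ∀ r ∈ R, ∀ u, w r u = 0
  free : ∀ f g : Module.Dual K U, R ≤ LinearMap.ker f → R ≤ LinearMap.ker g →
    ∃ θ : Module.Dual K X, ∀ x y, θ (w x y) = f x * g y - f y * g x

/-- `y` is covered by `L` if `L` contains some `y ∧ b` that is nonzero modulo `R`. -/
def Covered (R : Submodule K U) (w : U →ₗ[K] U →ₗ[K] X) (L : Submodule K X) (y : U) : Prop :=
  ∃ b, w y b ∈ L ∧ b ∉ R ⊔ K ∙ y

theorem mem_sup_span_singleton_iff {R : Submodule K U} {x y : U} :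
    x ∈ R ⊔ K ∙ y ↔ ∃ a : K, x - a • y ∈ R := by
  rw [Submodule.mem_sup]
  constructor
  · rintro ⟨r, hr, z, hz, rfl⟩
    obtain ⟨a, rfl⟩ := Submodule.mem_span_singleton.1 hz
    exact ⟨a, by simpa using hr⟩
  · rintro ⟨a, ha⟩
    exact ⟨_, ha, a • y, Submodule.smul_mem _ _ (Submodule.mem_span_singleton_self y), by simp⟩

theorem WedgeLike.mem_of_eq_zero {R : Submodule K U} {w : U →ₗ[K] U →ₗ[K] X}
    (hw : WedgeLike R w) {y b : U} (hy : y ∉ R) (h : w y b = 0) : b ∈ R ⊔ K ∙ y := by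
  by_contra hb
  obtain ⟨g, hgb, hg⟩ := Submodule.exists_le_ker_of_notMem hb
  obtain ⟨f, hfy, hf⟩ := Submodule.exists_le_ker_of_notMem hy
  obtain ⟨θ, hθ⟩ := hw.free f g hf (le_sup_left.trans hg)
  have hgy : g y = 0 :=
    hg ((le_sup_right : K ∙ y ≤ R ⊔ K ∙ y) (Submodule.mem_span_singleton_self y))
  have := hθ y b
  rw [h, hgy, map_zero, mul_zero, sub_zero] at this
  exact mul_ne_zero hfy hgb this.symm

/-- Passing to the quotient by b enlarges the radical R and leaves U unchanged, so the induction on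
dimension can keep a fixed ambient space. -/
theorem WedgeLike.quotient {R : Submodule K U} {w : U →ₗ[K] U →ₗ[K] X}
    (hw : WedgeLike R w) (b : U) :
    WedgeLike (R ⊔ K ∙ b) (w.compr₂ (LinearMap.range (w b)).mkQ) where
  alt x := by simp [hw.alt x]
  rad r hr u := by
    obtain ⟨a, ha⟩ := mem_sup_span_singleton_iff.1 hr
    have h := hw.rad _ ha u
    rw [map_sub, LinearMap.sub_apply, sub_eq_zero] at h
    simp only [LinearMap.compr₂_apply, Submodule.mkQ_apply, Submodule.Quotient.mk_eq_zero, h]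
    exact ⟨a • u, by simp⟩
  free f g hf hg := by
    obtain ⟨θ, hθ⟩ := hw.free f g (le_sup_left.trans hf) (le_sup_left.trans hg)
    have hb : b ∈ R ⊔ K ∙ b :=
      (le_sup_right : K ∙ b ≤ R ⊔ K ∙ b) (Submodule.mem_span_singleton_self b)
    have hfb : f b = 0 := hf hb
    have hgb : g b = 0 := hg hb
    refine ⟨(LinearMap.range (w b)).liftQ θ ?_, fun x y => ?_⟩
    · rintro _ ⟨u, rfl⟩
      simp [hθ, hfb, hgb]
    · simpa using hθ x y

/-- If the partner b of y becomes dependent on y modulo b₀, then y ∧ b = c (y ∧ b₀). Either c = 0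
and b was already dependent, or y ∧ b₀ lies in L; both are excluded. -/
theorem Covered.quotient {R : Submodule K U} {w : U →ₗ[K] U →ₗ[K] X}
    (hw : WedgeLike R w) {L : Submodule K X} {y b₀ : U} (hy : Covered R w L y)
    (hb₀ : w b₀ y ∉ L) :
    Covered (R ⊔ K ∙ b₀) (w.compr₂ (LinearMap.range (w b₀)).mkQ)
      (L.map (LinearMap.range (w b₀)).mkQ) y := by
  obtain ⟨b, hbL, hb⟩ := hy
  refine ⟨b, Submodule.mem_map_of_mem hbL, fun h => ?_⟩
  obtain ⟨a, ha⟩ := mem_sup_span_singleton_iff.1 h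
  obtain ⟨c, hc⟩ := mem_sup_span_singleton_iff.1 ha
  have h1 : w y b = c • w y b₀ := by
    have h2 := hw.rad _ hc y
    rw [← hw.alt.neg, neg_eq_zero] at h2
    have h3 : w y y = 0 := hw.alt y
    simp only [map_sub, map_smul, h3, smul_zero, sub_zero] at h2
    exact sub_eq_zero.1 h2
  by_cases hc0 : c = 0
  · subst hc0
    rw [zero_smul, sub_zero] at hc
    exact hb (mem_sup_span_singleton_iff.2 ⟨a, hc⟩)
  · apply hb₀
    rw [← hw.alt.neg]
    refine L.neg_mem ?_
    rw [h1] at hbL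
    simpa [smul_smul, hc0] using L.smul_mem c⁻¹ hbL

theorem finrank_eq_finrank_map_add_finrank_inf_ker [FiniteDimensional K U] (f : U →ₗ[K] X)
    (E : Submodule K U) :
    Module.finrank K E = Module.finrank K (E.map f) +
      Module.finrank K (E ⊓ LinearMap.ker f : Submodule K U) := by
  rw [← (f.domRestrict E).finrank_range_add_finrank_ker, LinearMap.range_domRestrict,
    LinearMap.ker_domRestrict,
    (Submodule.equivSubtypeMap E ((LinearMap.ker f).comap E.subtype)).finrank_eq,
    Submodule.map_comap_subtype]

theorem exists_hyperplane_notMem [FiniteDimensional K U] {J D : Submodule K U} (hJ : J ≤ D) {e : U}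
    (heJ : e ∉ J) :
    ∃ D' ≤ D, J ≤ D' ∧ e ∉ D' ∧ Module.finrank K D ≤ Module.finrank K D' + 1 := by
  obtain ⟨f, hf, hJf⟩ := Submodule.exists_le_ker_of_notMem heJ
  refine ⟨D ⊓ LinearMap.ker f, inf_le_left, le_inf hJ hJf, fun h => hf h.2, ?_⟩
  have := finrank_eq_finrank_map_add_finrank_inf_ker f D
  have h1 := Submodule.finrank_le (D.map f)
  rw [Module.finrank_self] at h1
  omega

end Wedge

/-! ### The covering bound, by induction on dim D. -/

section Covering

universe v

variable {K U : Type*} [Field K] [AddCommGroup U] [Module K U] [FiniteDimensional K U]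

/-- Split dim L along the quotient by b ∧ U. The image of L has dimension at least dim D₁ by
induction, and the kernel part contains b ∧ y₀ and every b ∧ δ in L with δ ∈ D. -/
theorem finrank_le_of_covered_aux {X : Type v} [AddCommGroup X] [Module K X]
    [FiniteDimensional K X] {R D : Submodule K U} {w : U →ₗ[K] U →ₗ[K] X} {L : Submodule K X}
    {p b y₀ : U} (hw : WedgeLike R w)
    (ih : ∀ {X' : Type v} [AddCommGroup X'] [Module K X'] [FiniteDimensional K X']
      (R' D' : Submodule K U) (w' : U →ₗ[K] U →ₗ[K] X') (L' : Submodule K X') (p' : U),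
      WedgeLike R' w' → Disjoint D' R' → p' ∉ D' ⊔ R' →
      (∀ a ∈ D', a ≠ 0 → Covered R' w' L' (p' + a)) →
      Module.finrank K D' < Module.finrank K D → Module.finrank K D' ≤ Module.finrank K L')
    (hcov : ∀ a ∈ D, a ≠ 0 → Covered R w L (p + a))
    (hby : w b y₀ ∈ L) {D₁ : Submodule K U} (hD₁ : D₁ < D) {a : U} (ha : a ∈ D)
    (hdis : Disjoint D₁ (R ⊔ K ∙ b)) (hp : p + a ∉ D₁ ⊔ (R ⊔ K ∙ b))
    (hne : ∀ x ∈ D₁, x ≠ 0 → a + x ≠ 0) (hx : ∀ x ∈ D₁, x ≠ 0 → w b (p + a + x) ∉ L) :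
    Module.finrank K D₁ + Module.finrank K
      (((D ⊓ L.comap (w b)) ⊔ K ∙ y₀).map (w b)) ≤ Module.finrank K L := by
  have h1 := ih (R ⊔ K ∙ b) D₁ (w.compr₂ (LinearMap.range (w b)).mkQ)
    (L.map (LinearMap.range (w b)).mkQ) (p + a) (hw.quotient b) hdis hp
    (fun x hx1 hx0 => Covered.quotient hw
      (by rw [add_assoc]; exact hcov _ (D.add_mem ha (hD₁.le hx1)) (hne x hx1 hx0))
      (hx x hx1 hx0)) (Submodule.finrank_lt_finrank_of_lt hD₁)
  have h2 := finrank_eq_finrank_map_add_finrank_inf_ker (LinearMap.range (w b)).mkQ L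
  rw [Submodule.ker_mkQ] at h2
  have h3 : ((D ⊓ L.comap (w b)) ⊔ K ∙ y₀).map (w b) ≤ L ⊓ LinearMap.range (w b) := by
    refine le_inf ?_ LinearMap.map_le_range
    rw [Submodule.map_le_iff_le_comap]
    refine sup_le inf_le_right ?_
    rw [Submodule.span_singleton_le_iff_mem]
    exact hby
  have h4 := Submodule.finrank_mono h3
  omega

/-- If every point of the affine subspace `p + D`, except possibly `p`, is covered by `L`, then
`dim D ≤ dim L`. -/
theorem finrank_le_of_covered (d : ℕ) : ∀ {X : Type v} [AddCommGroup X] [Module K X]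
    [FiniteDimensional K X] (R D : Submodule K U) (w : U →ₗ[K] U →ₗ[K] X) (L : Submodule K X)
    (p : U), WedgeLike R w → Disjoint D R → p ∉ D ⊔ R →
    (∀ a ∈ D, a ≠ 0 → Covered R w L (p + a)) → Module.finrank K D = d →
    Module.finrank K D ≤ Module.finrank K L := by
  induction d using Nat.strong_induction_on with
  | _ d ih =>
  intro X _ _ _ R D w L p hw hDR hp hcov hd
  have ih' : ∀ {X' : Type v} [AddCommGroup X'] [Module K X'] [FiniteDimensional K X']
      (R' D' : Submodule K U) (w' : U →ₗ[K] U →ₗ[K] X') (L' : Submodule K X') (p' : U),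
      WedgeLike R' w' → Disjoint D' R' → p' ∉ D' ⊔ R' →
      (∀ a ∈ D', a ≠ 0 → Covered R' w' L' (p' + a)) →
      Module.finrank K D' < Module.finrank K D → Module.finrank K D' ≤ Module.finrank K L' :=
    fun R' D' w' L' p' h1 h2 h3 h4 h5 => ih _ (hd ▸ h5) R' D' w' L' p' h1 h2 h3 h4 rfl
  by_cases hD : D = ⊥
  · subst hD; simp
  obtain ⟨w₀, hw₀D, hw₀⟩ := Submodule.exists_mem_ne_zero_of_ne_bot hD
  -- Since p may be uncovered, the argument is centred at the covered point y₀ = p + w₀.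
  obtain ⟨y₀, rfl⟩ : ∃ y₀, p = y₀ - w₀ := ⟨p + w₀, by simp⟩
  have hy₀ : y₀ ∉ D ⊔ R := fun h =>
    hp ((D ⊔ R).sub_mem h ((le_sup_left : D ≤ D ⊔ R) hw₀D))
  have hDR0 : ∀ x ∈ D, x ∈ R → x = 0 := fun x h1 h2 => Submodule.disjoint_def.1 hDR x h1 h2
  have key : ∀ δ ∈ D, ∀ α : K, δ + α • y₀ ∈ R → α = 0 ∧ δ = 0 := by
    intro δ hδ α h
    have hα : α = 0 := by
      by_contra hα
      apply hy₀
      have : α • y₀ ∈ D ⊔ R := by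
        have := (D ⊔ R).sub_mem ((le_sup_right : R ≤ D ⊔ R) h) ((le_sup_left : D ≤ D ⊔ R) hδ)
        simpa using this
      exact ((D ⊔ R).smul_mem_iff hα).1 this
    subst hα
    exact ⟨rfl, hDR0 δ hδ (by simpa using h)⟩
  have hE : ∀ b, Module.finrank K ((D ⊓ L.comap (w b)) ⊔ K ∙ y₀ : Submodule K U) =
      Module.finrank K (D ⊓ L.comap (w b) : Submodule K U) + 1 := by
    intro b
    have h1 := Submodule.finrank_sup_add_finrank_inf_eq (D ⊓ L.comap (w b)) (K ∙ y₀)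
    have hne : y₀ ≠ 0 := fun h => hy₀ (h ▸ Submodule.zero_mem _)
    have h2 : (D ⊓ L.comap (w b)) ⊓ K ∙ y₀ = ⊥ := by
      rw [← disjoint_iff, Submodule.disjoint_span_singleton' hne]
      exact fun h => hy₀ ((le_sup_left : D ≤ D ⊔ R) h.1)
    rw [h2, finrank_span_singleton hne, finrank_bot] at h1
    omega
  have hmapL : ∀ b, w y₀ b ∈ L → w b y₀ ∈ L := fun b h => by
    rw [← hw.alt.neg]; exact L.neg_mem h
  -- Either a nonzero b in D has y₀ ∧ b ∈ L, or the partner b that covers y₀ is independent of D and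
  -- y₀ modulo R.
  by_cases hcase : ∃ b ∈ D, b ≠ 0 ∧ w y₀ b ∈ L
  · obtain ⟨b, hbD, hb0, hbL⟩ := hcase
    have hbb : w b b = 0 := hw.alt b
    have hby := hmapL b hbL
    set D₀ := D ⊓ L.comap (w b) with hD₀
    have hbD₀ : b ∈ D₀ := ⟨hbD, by simp [hbb]⟩
    have hker : ((D₀ ⊔ K ∙ y₀) ⊓ LinearMap.ker (w b)) ≤ K ∙ b := by
      rintro q ⟨hq, hqb⟩
      obtain ⟨β, hβ⟩ := mem_sup_span_singleton_iff.1
        (hw.mem_of_eq_zero (fun h => hb0 (hDR0 b hbD h)) hqb)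
      obtain ⟨α, hα⟩ := mem_sup_span_singleton_iff.1 hq
      have := key (q - α • y₀ - β • b) (D.sub_mem hα.1 (D.smul_mem _ hbD)) α
        (by convert hβ using 1; abel)
      rw [this.1, zero_smul, sub_zero] at this
      exact Submodule.mem_span_singleton.2 ⟨β, (sub_eq_zero.1 this.2).symm⟩
    have hdim : Module.finrank K D₀ ≤ Module.finrank K ((D₀ ⊔ K ∙ y₀).map (w b)) := by
      have h1 := finrank_eq_finrank_map_add_finrank_inf_ker (w b) (D₀ ⊔ K ∙ y₀)
      have h2 := Submodule.finrank_mono hker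
      rw [finrank_span_singleton hb0] at h2
      have h3 := hE b
      rw [← hD₀] at h3
      omega
    -- In the quotient by b the new base point is y₀ + e + tb. As b ∧ y₀ ∈ L, the condition on its
    -- translate by x reduces to e + x ∉ D₀. When e = 0 the base point itself may lose its covering,
    -- which is why the statement exempts p.
    have step : ∀ D₁ ≤ D, b ∉ D₁ → ∀ e ∈ D, (∀ x ∈ D₁, x ≠ 0 → e + x ∉ D₀) →
        Module.finrank K D₁ + Module.finrank K D₀ ≤ Module.finrank K L := by
      intro D₁ hD₁ hbD₁ e he hx
      -- The shift by tb is invisible modulo b; it keeps the translates away from the exempt point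
      -- p.
      obtain ⟨t, ht⟩ : ∃ t : K, w₀ + e + t • b ∉ D₁ := by
        by_cases h : w₀ + e ∈ D₁
        · exact ⟨1, fun h' => hbD₁ (by simpa using D₁.sub_mem h' h)⟩
        · exact ⟨0, by simpa using h⟩
      have haD : w₀ + e + t • b ∈ D := D.add_mem (D.add_mem hw₀D he) (D.smul_mem _ hbD)
      refine (Nat.add_le_add_left hdim _).trans (finrank_le_of_covered_aux hw ih' hcov hby
        (lt_of_le_of_ne hD₁ (fun h => hbD₁ (h ▸ hbD))) haD ?_ ?_ ?_ ?_)
      · rw [Submodule.disjoint_def]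
        intro x hx1 hx2
        obtain ⟨β, hβ⟩ := mem_sup_span_singleton_iff.1 hx2
        have h0 := sub_eq_zero.1 (hDR0 _ (D.sub_mem (hD₁ hx1) (D.smul_mem _ hbD)) hβ)
        by_cases hβ0 : β = 0
        · simpa [hβ0] using h0
        · exact absurd ((D₁.smul_mem_iff hβ0).1 (h0 ▸ hx1)) hbD₁
      · intro h
        apply hy₀
        have hle : D₁ ⊔ (R ⊔ K ∙ b) ≤ D ⊔ R := sup_le (hD₁.trans le_sup_left)
          (sup_le le_sup_right ((Submodule.span_singleton_le_iff_mem _ _).2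
            ((le_sup_left : D ≤ D ⊔ R) hbD)))
        have := (D ⊔ R).sub_mem (hle h)
          ((le_sup_left : D ≤ D ⊔ R) (D.add_mem he (D.smul_mem t hbD)))
        convert this using 1
        abel
      · intro x hx1 _ h0
        exact ht (by rw [eq_neg_of_add_eq_zero_left h0]; exact D₁.neg_mem hx1)
      · intro x hx1 hx0 h
        refine hx x hx1 hx0 ⟨D.add_mem he (hD₁ hx1), ?_⟩
        have h2 := L.sub_mem h hby
        change w b (e + x) ∈ L
        convert h2 using 1
        simp only [map_add, map_sub, map_smul, hbb, smul_zero]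
        abel
    by_cases hle : D ≤ D₀
    · have := Submodule.finrank_mono hle
      have := step ⊥ bot_le (by simpa using hb0) 0 D.zero_mem (by simp)
      rw [finrank_bot] at this
      omega
    · obtain ⟨e, he, heD₀⟩ := SetLike.not_le_iff_exists.1 hle
      -- Two dimensions are lost in D₁ here, one to separate e from D₀ and one to avoid b; dim D₀ ≥
      -- 2 makes up for them. Otherwise D₀ = Kb, so avoiding b already avoids D₀ and only one
      -- dimension is lost.
      by_cases h2 : 2 ≤ Module.finrank K D₀
      · obtain ⟨D', hD', hJ, heD', hdim'⟩ := exists_hyperplane_notMem (inf_le_left : D₀ ≤ D) heD₀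
        obtain ⟨D₁, hD₁, -, hbD₁, hdim₁⟩ :=
          exists_hyperplane_notMem (bot_le : ⊥ ≤ D') (e := b) (by simpa using hb0)
        have := step D₁ (hD₁.trans hD') hbD₁ e he
          (fun x hx _ h => heD' (by simpa using D'.sub_mem (hJ h) (hD₁ hx)))
        omega
      · obtain ⟨D₁, hD₁, -, hbD₁, hdim₁⟩ :=
          exists_hyperplane_notMem (bot_le : ⊥ ≤ D) (e := b) (by simpa using hb0)
        have hspan : K ∙ b = D₀ := Submodule.eq_of_le_of_finrank_le
          ((Submodule.span_singleton_le_iff_mem _ _).2 hbD₀)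
          (by rw [finrank_span_singleton hb0]; omega)
        have h1 : Module.finrank K D₀ = 1 := by rw [← hspan, finrank_span_singleton hb0]
        have := step D₁ hD₁ hbD₁ 0 D.zero_mem (fun x hx hx0 h => by
          rw [zero_add, ← hspan] at h
          obtain ⟨c, rfl⟩ := Submodule.mem_span_singleton.1 h
          exact hbD₁ ((D₁.smul_mem_iff (fun hc => hx0 (by simp [hc]))).1 hx))
        omega
  · push Not at hcase
    obtain ⟨b, hbL, hb⟩ : Covered R w L y₀ := by simpa using hcov w₀ hw₀D hw₀
    have hby := hmapL b hbL
    have key₂ : ∀ δ ∈ D, ∀ α β : K, δ + α • y₀ - β • b ∈ R → β = 0 := by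
      intro δ hδ α β h
      by_contra hβ
      by_cases hδ0 : δ = 0
      · apply hb
        rw [← Submodule.smul_mem_iff _ hβ, mem_sup_span_singleton_iff]
        refine ⟨α, ?_⟩
        have := R.neg_mem h
        rw [hδ0] at this
        convert this using 1
        abel
      · refine hcase δ hδ hδ0 ?_
        have h1 := hw.rad _ h y₀
        rw [← hw.alt.neg, neg_eq_zero] at h1
        have h2 : w y₀ y₀ = 0 := hw.alt y₀
        simp only [map_add, map_sub, map_smul, h2, smul_zero, add_zero, sub_eq_zero] at h1
        rw [h1]
        exact L.smul_mem _ hbL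
    set D₀ := D ⊓ L.comap (w b) with hD₀
    have hbR : b ∉ R := fun h => hb ((le_sup_left : R ≤ _) h)
    have hker : ((D₀ ⊔ K ∙ y₀) ⊓ LinearMap.ker (w b)) = ⊥ := by
      rw [eq_bot_iff]
      rintro q ⟨hq, hqb⟩
      obtain ⟨β, hβ⟩ := mem_sup_span_singleton_iff.1 (hw.mem_of_eq_zero hbR hqb)
      obtain ⟨α, hα⟩ := mem_sup_span_singleton_iff.1 hq
      have hβ0 := key₂ _ hα.1 α β (by simpa using hβ)
      have := key _ hα.1 α (by simpa [hβ0] using hβ)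
      simpa [this.1] using this.2
    -- Now b ∧ · is injective on D₀ + Ky₀, so y₀ contributes one extra dimension; it pays for the
    -- hyperplane taken below.
    have hdim : Module.finrank K ((D₀ ⊔ K ∙ y₀).map (w b)) = Module.finrank K D₀ + 1 := by
      have h1 := finrank_eq_finrank_map_add_finrank_inf_ker (w b) (D₀ ⊔ K ∙ y₀)
      rw [hker, finrank_bot] at h1
      have h3 := hE b
      rw [← hD₀] at h3
      omega
    by_cases hle : D ≤ D₀ ⊔ K ∙ w₀
    · have h1 := Submodule.finrank_mono hle
      have h2 := Submodule.finrank_add_le_finrank_add_finrank D₀ (K ∙ w₀)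
      rw [finrank_span_singleton hw₀] at h2
      have h3 : (D₀ ⊔ K ∙ y₀).map (w b) ≤ L := by
        rw [Submodule.map_le_iff_le_comap]
        exact sup_le inf_le_right ((Submodule.span_singleton_le_iff_mem _ _).2 hby)
      have h4 := Submodule.finrank_mono h3
      omega
    · obtain ⟨e, he, heJ⟩ := SetLike.not_le_iff_exists.1 hle
      obtain ⟨D', hD', hJ, heD', hdim'⟩ := exists_hyperplane_notMem
        (sup_le inf_le_left ((Submodule.span_singleton_le_iff_mem _ _).2 hw₀D) :
          D₀ ⊔ K ∙ w₀ ≤ D) heJ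
      have hw₀D' : w₀ ∈ D' := hJ ((le_sup_right : K ∙ w₀ ≤ _) (Submodule.mem_span_singleton_self _))
      have := finrank_le_of_covered_aux hw ih' hcov hby
        (lt_of_le_of_ne hD' (fun h => heD' (h ▸ he))) (D.add_mem hw₀D he) ?_ ?_ ?_ ?_
      · rw [← hD₀, hdim] at this
        omega
      · rw [Submodule.disjoint_def]
        intro x hx1 hx2
        obtain ⟨β, hβ⟩ := mem_sup_span_singleton_iff.1 hx2
        have hβ0 := key₂ x (hD' hx1) 0 β (by simpa using hβ)
        exact hDR0 x (hD' hx1) (by simpa [hβ0] using hβ)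
      · intro h
        rw [← sup_assoc] at h
        obtain ⟨β, hβ⟩ := mem_sup_span_singleton_iff.1 h
        obtain ⟨x, hx, r, hr, hxr⟩ := Submodule.mem_sup.1 hβ
        have hβ0 := key₂ (e - x) (D.sub_mem he (hD' hx)) 1 β (by
          convert hr using 1
          rw [← sub_eq_iff_eq_add'.2 hxr.symm, one_smul]
          abel)
        have := key (e - x) (D.sub_mem he (hD' hx)) 1 (by
          convert hr using 1
          rw [← sub_eq_iff_eq_add'.2 hxr.symm, one_smul, hβ0, zero_smul]
          abel)
        exact one_ne_zero this.1
      · intro x hx _ h0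
        refine heD' ?_
        have : e = -(w₀ + x) := by rw [eq_neg_iff_add_eq_zero, ← h0]; abel
        rw [this]
        exact D'.neg_mem (D'.add_mem hw₀D' hx)
      · intro x hx _ h
        have h1 : e + x ∈ D₀ := by
          refine ⟨D.add_mem he (hD' hx), ?_⟩
          change w b (e + x) ∈ L
          convert L.sub_mem h hby using 1
          simp only [map_add, map_sub]
          abel
        exact heD' (by simpa using D'.sub_mem (hJ ((le_sup_left : D₀ ≤ _) h1)) hx)

end Covering

/-! ### Ordinary vectors and ordinary pairs for S. -/

section AlternatingSpaces

variable {K : Type*} [Field K] {n : ℕ}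

theorem dotProduct_mulVec_swap {M : Matrix (Fin n) (Fin n) K} (hM : M ∈ altMatrices n K)
    (x y : Fin n → K) : x ⬝ᵥ (M *ᵥ y) = -(y ⬝ᵥ (M *ᵥ x)) := by
  have h := hM (x + y)
  have hx := hM x
  have hy := hM y
  rw [mulVec_add, add_dotProduct, dotProduct_add, dotProduct_add, hx, hy, zero_add, add_zero] at h
  exact eq_neg_of_add_eq_zero_left h

theorem exists_dotProduct_eq (f : Module.Dual K (Fin n → K)) : ∃ b, ∀ v, f v = b ⬝ᵥ v :=
  ⟨(dotProductEquiv K (Fin n)).symm f, fun v => by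
    rw [← dotProductEquiv_apply_apply, LinearEquiv.apply_symm_apply]⟩

/-- Evaluation of matrices at a vector, as a linear map. -/
def mulVecAt (z : Fin n → K) : Matrix (Fin n) (Fin n) K →ₗ[K] (Fin n → K) where
  toFun M := M *ᵥ z
  map_add' M N := Matrix.add_mulVec M N z
  map_smul' c M := Matrix.smul_mulVec c M z

/-- The wedge product of `x` and `y`, as the linear form `M ↦ xᵀ M y` on alternating matrices. -/
noncomputable def altWedge (n : ℕ) (K : Type*) [Field K] :
    (Fin n → K) →ₗ[K] (Fin n → K) →ₗ[K] Module.Dual K (altMatrices n K) :=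
  LinearMap.mk₂ K
    (fun x y =>
      { toFun := fun M => x ⬝ᵥ ((M : Matrix (Fin n) (Fin n) K) *ᵥ y)
        map_add' := fun M N => by
          rw [Submodule.coe_add, Matrix.add_mulVec, dotProduct_add]
        map_smul' := fun c M => by
          rw [Submodule.coe_smul, Matrix.smul_mulVec, dotProduct_smul, RingHom.id_apply] })
    (fun x x' y => by
      ext M
      simp only [LinearMap.coe_mk, AddHom.coe_mk, LinearMap.add_apply]
      rw [add_dotProduct])
    (fun c x y => by
      ext M
      simp only [LinearMap.coe_mk, AddHom.coe_mk, LinearMap.smul_apply]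
      rw [smul_dotProduct])
    (fun x y y' => by
      ext M
      simp only [LinearMap.coe_mk, AddHom.coe_mk, LinearMap.add_apply]
      rw [mulVec_add, dotProduct_add])
    (fun c x y => by
      ext M
      simp only [LinearMap.coe_mk, AddHom.coe_mk, LinearMap.smul_apply]
      rw [mulVec_smul, dotProduct_smul])

@[simp]
theorem altWedge_apply (x y : Fin n → K) (M : altMatrices n K) :
    altWedge n K x y M = x ⬝ᵥ ((M : Matrix (Fin n) (Fin n) K) *ᵥ y) := rfl

theorem wedgeLike_altWedge : WedgeLike ⊥ (altWedge n K) where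
  alt x := by
    ext M
    exact M.2 x
  rad r hr u := by
    rw [(Submodule.mem_bot K).1 hr, map_zero, LinearMap.zero_apply]
  free f g _ _ := by
    obtain ⟨φ, hφ⟩ := exists_dotProduct_eq f
    obtain ⟨ψ, hψ⟩ := exists_dotProduct_eq g
    have key : ∀ x y : Fin n → K, x ⬝ᵥ ((vecMulVec φ ψ - vecMulVec ψ φ) *ᵥ y) =
        f x * g y - f y * g x := by
      intro x y
      rw [sub_mulVec, vecMulVec_mulVec, vecMulVec_mulVec, dotProduct_sub, op_smul_eq_smul,
        op_smul_eq_smul, dotProduct_smul, dotProduct_smul, hφ, hφ, hψ, hψ, smul_eq_mul,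
        smul_eq_mul, dotProduct_comm x φ, dotProduct_comm x ψ]
      ring
    exact ⟨Module.Dual.eval K _ ⟨vecMulVec φ ψ - vecMulVec ψ φ, fun x => by rw [key]; ring⟩, key⟩

/-- The linear forms on `A_n(K)` that vanish on `S`. -/
def altAnnihilator (S : Submodule K (Matrix (Fin n) (Fin n) K)) :
    Submodule K (Module.Dual K (altMatrices n K)) :=
  (S.submoduleOf (altMatrices n K)).dualAnnihilator

theorem mem_altAnnihilator {S : Submodule K (Matrix (Fin n) (Fin n) K)}
    {θ : Module.Dual K (altMatrices n K)} :
    θ ∈ altAnnihilator S ↔ ∀ M : altMatrices n K, (M : Matrix (Fin n) (Fin n) K) ∈ S → θ M = 0 :=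
  Submodule.mem_dualAnnihilator _

theorem finrank_altAnnihilator (S : Submodule K (Matrix (Fin n) (Fin n) K)) :
    Module.finrank K (altAnnihilator S) = codimIn S (altMatrices n K) := by
  rw [altAnnihilator, ← (Submodule.dualQuotEquivDualAnnihilator _).finrank_eq,
    Subspace.dual_finrank_eq, codimIn]

/-- `z` is ordinary for `S` if `S z` is as large as alternation allows. -/
def Ordinary (S : Submodule K (Matrix (Fin n) (Fin n) K)) (z : Fin n → K) : Prop :=
  ∀ v, v ⬝ᵥ z = 0 → ∃ M ∈ S, M *ᵥ z = v

/-- `x, z` form an ordinary pair for `S` if `{(M x, M z) | M ∈ S}` is as large as alternation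
allows. -/
def OrdinaryPair (S : Submodule K (Matrix (Fin n) (Fin n) K)) (x z : Fin n → K) : Prop :=
  ∀ v w, v ⬝ᵥ x = 0 → w ⬝ᵥ z = 0 → v ⬝ᵥ z + w ⬝ᵥ x = 0 → ∃ M ∈ S, M *ᵥ x = v ∧ M *ᵥ z = w

variable {S : Submodule K (Matrix (Fin n) (Fin n) K)} {x z : Fin n → K}

theorem OrdinaryPair.symm (h : OrdinaryPair S x z) : OrdinaryPair S z x := fun v w hv hw hvw => by
  obtain ⟨M, hM, h1, h2⟩ := h w v hw hv (by rwa [add_comm])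
  exact ⟨M, hM, h2, h1⟩

theorem Ordinary.ne_zero (hn : 3 ≤ n) (hz : Ordinary S z) : z ≠ 0 := by
  rintro rfl
  obtain ⟨M, -, hM⟩ := hz (fun _ => 1) (by simp)
  rw [mulVec_zero] at hM
  exact zero_ne_one (congrFun hM ⟨0, by omega⟩)

/-- A form b· that vanishes on Sz but not at some v ⊥ z puts z ∧ b in the annihilator, and b is not
in Kz because v ⊥ z. -/
theorem covered_of_not_ordinary (hz : ¬ Ordinary S z) :
    Covered ⊥ (altWedge n K) (altAnnihilator S) z := by
  unfold Ordinary at hz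
  push Not at hz
  obtain ⟨v, hv, hM⟩ := hz
  obtain ⟨f, hfv, hf⟩ := Submodule.exists_le_ker_of_notMem (p := S.map (mulVecAt z)) (v := v)
    (by rintro ⟨M, h1, h2⟩; exact hM M h1 h2)
  obtain ⟨b, hb⟩ := exists_dotProduct_eq f
  refine ⟨b, mem_altAnnihilator.2 fun M hMS => ?_, fun h => ?_⟩
  · have : b ⬝ᵥ ((M : Matrix (Fin n) (Fin n) K) *ᵥ z) = 0 := by
      rw [← hb]; exact hf ⟨_, hMS, rfl⟩
    rw [altWedge_apply, dotProduct_mulVec_swap M.2, this, neg_zero]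
  · rw [bot_sup_eq] at h
    obtain ⟨a, rfl⟩ := Submodule.mem_span_singleton.1 h
    apply hfv
    rw [hb, smul_dotProduct, dotProduct_comm, hv, smul_zero]

/-- A form (b, c) that vanishes on all (Mx, Mz) gives x ∧ b + z ∧ c in the annihilator, hence x ∧ b
modulo z ∧ Kⁿ. -/
theorem covered_of_not_ordinaryPair (hS : S ≤ altMatrices n K) (hz : Ordinary S z)
    (hxz : ¬ OrdinaryPair S x z) :
    Covered (⊥ ⊔ K ∙ z) ((altWedge n K).compr₂ (LinearMap.range (altWedge n K z)).mkQ)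
      ((altAnnihilator S).map (LinearMap.range (altWedge n K z)).mkQ) x := by
  unfold OrdinaryPair at hxz
  push Not at hxz
  obtain ⟨v, w, hvx, hwz, hvw, hM⟩ := hxz
  obtain ⟨f, hfv, hf⟩ := Submodule.exists_le_ker_of_notMem
    (p := S.map ((mulVecAt x).prod (mulVecAt z))) (v := (v, w))
    (by rintro ⟨M, h1, h2⟩; exact hM M h1 (congrArg Prod.fst h2) (congrArg Prod.snd h2))
  obtain ⟨b, hb⟩ := exists_dotProduct_eq (f.comp (LinearMap.inl K _ _))
  obtain ⟨c, hc⟩ := exists_dotProduct_eq (f.comp (LinearMap.inr K _ _))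
  have hbc : ∀ v w, f (v, w) = b ⬝ᵥ v + c ⬝ᵥ w := fun v w => by
    rw [← hb, ← hc, LinearMap.comp_apply, LinearMap.comp_apply, ← map_add]; simp
  have hS0 : ∀ M ∈ S, b ⬝ᵥ (M *ᵥ x) + c ⬝ᵥ (M *ᵥ z) = 0 := fun M hMS => by
    rw [← hbc]; exact hf ⟨M, hMS, rfl⟩
  refine ⟨b, ⟨altWedge n K x b + altWedge n K z c, mem_altAnnihilator.2 fun M hMS => ?_, ?_⟩,
    fun h => ?_⟩
  · have := hS0 M hMS
    rw [LinearMap.add_apply, altWedge_apply, altWedge_apply, dotProduct_mulVec_swap M.2 x,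
      dotProduct_mulVec_swap M.2 z, ← neg_add, this, neg_zero]
  · rw [map_add]
    have : (LinearMap.range (altWedge n K z)).mkQ (altWedge n K z c) = 0 := by simp
    rw [this, add_zero]
    rfl
  · rw [bot_sup_eq] at h
    obtain ⟨β', hβ', α', hα', rfl⟩ := Submodule.mem_sup.1 h
    obtain ⟨β, rfl⟩ := Submodule.mem_span_singleton.1 hβ'
    obtain ⟨α, rfl⟩ := Submodule.mem_span_singleton.1 hα'
    -- If b were in the span of z and x, then (b, c) would take the same value at (v, w) as at (Mx,
    -- Mz) for any M in S with Mz = w, namely 0.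
    obtain ⟨M, hMS, hMz⟩ := hz w hwz
    apply hfv
    rw [← hS0 M hMS, hbc, hMz]
    simp only [add_dotProduct, smul_dotProduct, smul_eq_mul, hS hMS x,
      dotProduct_mulVec_swap (hS hMS) z x, hMz]
    rw [dotProduct_comm x v, hvx, dotProduct_comm z v, dotProduct_comm x w,
      eq_neg_of_add_eq_zero_left hvw]

theorem exists_ordinary (hS : codimIn S (altMatrices n K) + 3 ≤ n) : ∃ z, Ordinary S z := by
  by_contra! h
  let f : Module.Dual K (Fin n → K) := LinearMap.proj ⟨0, by omega⟩
  have hf : f (fun _ => 1) = 1 := rfl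
  have h1 := finrank_le_of_covered _ ⊥ (LinearMap.ker f) (altWedge n K) (altAnnihilator S)
    (fun _ => 1) wedgeLike_altWedge disjoint_bot_right
    (by rw [sup_bot_eq, LinearMap.mem_ker, hf]; exact one_ne_zero)
    (fun a _ _ => covered_of_not_ordinary (h _)) rfl
  rw [finrank_altAnnihilator] at h1
  have h2 := f.finrank_range_add_finrank_ker
  have h3 := Submodule.finrank_le (LinearMap.range f)
  rw [Module.finrank_self] at h3
  rw [Module.finrank_fin_fun] at h2
  omega

theorem exists_ordinaryPair (hSA : S ≤ altMatrices n K)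
    (hS : codimIn S (altMatrices n K) + 3 ≤ n) (hz : Ordinary S z)
    {f : Module.Dual K (Fin n → K)} (hf : f ≠ 0) (hfz : f z = 0) :
    ∃ x, f x ≠ 0 ∧ OrdinaryPair S x z := by
  by_contra! h
  have hz0 : z ≠ 0 := hz.ne_zero (by omega)
  obtain ⟨p, hp⟩ : ∃ p, f p ≠ 0 := by
    by_contra! h0
    exact hf (LinearMap.ext h0)
  -- D avoids z inside ker f and has dimension at least n - 2, while f is constant and nonzero on p
  -- + D.
  obtain ⟨D, hD, -, hzD, hdim⟩ := exists_hyperplane_notMem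
    (bot_le : ⊥ ≤ LinearMap.ker f) (e := z) (by simpa using hz0)
  have h1 := finrank_le_of_covered _ _ D _
    ((altAnnihilator S).map (LinearMap.range (altWedge n K z)).mkQ) p
    (wedgeLike_altWedge.quotient z)
    (by rw [bot_sup_eq, Submodule.disjoint_span_singleton' hz0]; exact hzD)
    (fun hpD => hp ?_)
    (fun a ha _ => covered_of_not_ordinaryPair hSA hz (h _ ?_)) rfl
  · have h4 := Submodule.finrank_map_le (LinearMap.range (altWedge n K z)).mkQ (altAnnihilator S)
    rw [finrank_altAnnihilator] at h4
    have h2 := f.finrank_range_add_finrank_ker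
    have h3 := Submodule.finrank_le (LinearMap.range f)
    rw [Module.finrank_self] at h3
    rw [Module.finrank_fin_fun] at h2
    omega
  · refine (?_ : D ⊔ (⊥ ⊔ K ∙ z) ≤ LinearMap.ker f) hpD
    rw [bot_sup_eq]
    exact sup_le hD ((Submodule.span_singleton_le_iff_mem _ _).2 hfz)
  · rw [map_add, LinearMap.mem_ker.1 (hD ha), add_zero]
    exact hp

theorem eq_smul_add_smul_of_dotProduct {t : Fin n → K}
    (h : ∀ v, v ⬝ᵥ x = 0 → v ⬝ᵥ z = 0 → v ⬝ᵥ t = 0) : ∃ α β : K, t = α • x + β • z := by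
  have hmem : t ∈ K ∙ x ⊔ K ∙ z := by
    by_contra hn
    obtain ⟨f, hft, hf⟩ := Submodule.exists_le_ker_of_notMem hn
    obtain ⟨v, hv⟩ := exists_dotProduct_eq f
    rw [hv] at hft
    refine hft (h v ?_ ?_)
    · rw [← hv]
      exact hf ((le_sup_left : K ∙ x ≤ _) (Submodule.mem_span_singleton_self x))
    · rw [← hv]
      exact hf ((le_sup_right : K ∙ z ≤ _) (Submodule.mem_span_singleton_self z))
  obtain ⟨a, ha, b, hb, rfl⟩ := Submodule.mem_sup.1 hmem
  obtain ⟨α, rfl⟩ := Submodule.mem_span_singleton.1 ha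
  obtain ⟨β, rfl⟩ := Submodule.mem_span_singleton.1 hb
  exact ⟨α, β, rfl⟩

theorem exists_dotProduct_ne_zero {t : Fin n → K} (h : t ∉ K ∙ z) :
    ∃ v, v ⬝ᵥ z = 0 ∧ v ⬝ᵥ t ≠ 0 := by
  by_contra! hv
  obtain ⟨α, β, rfl⟩ := eq_smul_add_smul_of_dotProduct (x := z) (z := z) (fun v h1 _ => hv v h1)
  exact h (Submodule.mem_span_singleton.2 ⟨α + β, by rw [add_smul]⟩)

theorem OrdinaryPair.notMem_span (hn : 2 ≤ n) (h : OrdinaryPair S x z) : x ∉ K ∙ z := by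
  intro hx
  obtain ⟨a, rfl⟩ := Submodule.mem_span_singleton.1 hx
  obtain ⟨t, ht⟩ : ∃ t, t ∉ K ∙ z := by
    by_contra! htop
    have h1 := finrank_span_le_card (R := K) ({z} : Set (Fin n → K))
    rw [(Submodule.eq_top_iff'.2 htop : K ∙ z = ⊤), finrank_top, Module.finrank_fin_fun] at h1
    simp at h1
    omega
  obtain ⟨v, hvz, hvt⟩ := exists_dotProduct_ne_zero ht
  obtain ⟨M, -, h1, h2⟩ := h v 0 (by rw [dotProduct_smul, hvz, smul_zero]) (zero_dotProduct z)
    (by rw [hvz, zero_dotProduct, add_zero])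
  rw [mulVec_smul, h2, smul_zero] at h1
  exact hvt (by rw [← h1, zero_dotProduct])

theorem OrdinaryPair.left (hn : 2 ≤ n) (h : OrdinaryPair S x z) : Ordinary S x := by
  intro v hv
  obtain ⟨w, hwz, hwx⟩ := exists_dotProduct_ne_zero (h.notMem_span hn)
  obtain ⟨M, hM, h1, -⟩ := h v (-((v ⬝ᵥ z) / (w ⬝ᵥ x)) • w) hv
    (by rw [smul_dotProduct, hwz, smul_zero])
    (by rw [smul_dotProduct, smul_eq_mul, neg_mul, div_mul_cancel₀ _ hwx, add_neg_cancel])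
  exact ⟨M, hM, h1⟩

/-- A subspace that contains an ordinary vector and all its ordinary partners is everything. -/
theorem eq_top_of_ordinaryPair_mem (hSA : S ≤ altMatrices n K)
    (hS : codimIn S (altMatrices n K) + 3 ≤ n) (hz : Ordinary S z)
    {W : Submodule K (Fin n → K)} (hzW : z ∈ W) (hW : ∀ x, OrdinaryPair S x z → x ∈ W) :
    W = ⊤ := by
  by_contra hne
  obtain ⟨f, hf, hWf⟩ := Submodule.exists_le_ker_of_lt_top W (lt_top_iff_ne_top.2 hne)
  obtain ⟨x, hx, hxz⟩ := exists_ordinaryPair hSA hS hz hf (hWf hzW)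
  exact hx (hWf (hW x hxz))

theorem Ordinary.exists_pair (hSA : S ≤ altMatrices n K)
    (hS : codimIn S (altMatrices n K) + 3 ≤ n) (hz : Ordinary S z) : ∃ x, OrdinaryPair S x z := by
  by_contra! h
  have h1 := eq_top_of_ordinaryPair_mem hSA hS hz (Submodule.mem_span_singleton_self (R := K) z)
    (fun x hx => absurd hx (h x))
  have h2 := finrank_span_singleton (K := K) (hz.ne_zero (by omega))
  rw [h1, finrank_top, Module.finrank_fin_fun] at h2
  omega

end AlternatingSpaces

/-! ### Range-compatible homomorphisms are linear, then local. -/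

section RangeCompatibleMaps

variable {K : Type*} [Field K] {n : ℕ} {S : Submodule K (Matrix (Fin n) (Fin n) K)}

theorem RangeCompatible.dotProduct_eq_zero (hSA : S ≤ altMatrices n K) {F : S → (Fin n → K)}
    (hF : RangeCompatible F) {M : S} {x : Fin n → K}
    (h : (M : Matrix (Fin n) (Fin n) K) *ᵥ x = 0) : F M ⬝ᵥ x = 0 := by
  obtain ⟨u, hu⟩ := hF M
  rw [← hu, dotProduct_comm, mulVecLin_apply, dotProduct_mulVec_swap (hSA M.2), h,
    dotProduct_zero, neg_zero]

theorem RangeCompatible.dotProduct_eq (hSA : S ≤ altMatrices n K) {F : S →+ (Fin n → K)}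
    (hF : RangeCompatible F) {M N : S} {x : Fin n → K}
    (h : (M : Matrix (Fin n) (Fin n) K) *ᵥ x = (N : Matrix (Fin n) (Fin n) K) *ᵥ x) :
    F M ⬝ᵥ x = F N ⬝ᵥ x := by
  have := hF.dotProduct_eq_zero hSA (M := M - N) (x := x)
    (by rw [Submodule.coe_sub, sub_mulVec, h, sub_self])
  rwa [map_sub, sub_dotProduct, sub_eq_zero] at this

/-- On an ordinary pair, the two components of a range-compatible homomorphism are linked. -/
theorem RangeCompatible.dotProduct_smul_eq (hSA : S ≤ altMatrices n K) {F : S →+ (Fin n → K)}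
    (hF : RangeCompatible F) {M N : S} {x z : Fin n → K} (c : K)
    (hMx : (M : Matrix (Fin n) (Fin n) K) *ᵥ x = 0)
    (hNz : (N : Matrix (Fin n) (Fin n) K) *ᵥ z = 0)
    (h : (M : Matrix (Fin n) (Fin n) K) *ᵥ z = (N : Matrix (Fin n) (Fin n) K) *ᵥ x) :
    F (c • M) ⬝ᵥ z = c * (F N ⬝ᵥ x) := by
  -- Both cM and N send z + cx to cMz.
  have h1 := hF.dotProduct_eq hSA (M := c • M) (N := N) (x := z + c • x) (by
    rw [Submodule.coe_smul, smul_mulVec, mulVec_add, mulVec_add, mulVec_smul, mulVec_smul, hMx,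
      hNz, h, smul_zero, add_zero, zero_add])
  have h2 := hF.dotProduct_eq_zero hSA (M := c • M) (x := x)
    (by rw [Submodule.coe_smul, smul_mulVec, hMx, smul_zero])
  have h3 := hF.dotProduct_eq_zero hSA hNz
  rwa [dotProduct_add, dotProduct_add, dotProduct_smul, dotProduct_smul, h2, h3, smul_zero,
    add_zero, zero_add, smul_eq_mul] at h1

theorem RangeCompatible.map_smul_dotProduct_of_pair (hSA : S ≤ altMatrices n K)
    {F : S →+ (Fin n → K)} (hF : RangeCompatible F) {x z : Fin n → K} (hxz : OrdinaryPair S x z)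
    (c : K) {M : S} (hMx : (M : Matrix (Fin n) (Fin n) K) *ᵥ x = 0) :
    F (c • M) ⬝ᵥ z = c * (F M ⬝ᵥ z) := by
  have hMz : (M : Matrix (Fin n) (Fin n) K) *ᵥ z ⬝ᵥ x = 0 := by
    rw [dotProduct_comm, dotProduct_mulVec_swap (hSA M.2), hMx, dotProduct_zero, neg_zero]
  obtain ⟨N, hN, hNx, hNz⟩ := hxz _ 0 hMz (zero_dotProduct z)
    (by rw [dotProduct_comm, hSA M.2 z, zero_dotProduct, add_zero])
  have h1 := hF.dotProduct_smul_eq hSA (N := ⟨N, hN⟩) c hMx hNz hNx.symm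
  have h2 := hF.dotProduct_smul_eq hSA (N := ⟨N, hN⟩) 1 hMx hNz hNx.symm
  rw [one_smul, one_mul] at h2
  rw [h1, h2]

theorem exists_add_eq_of_dotProduct {x x' z v : Fin n → K} (hx' : x' ∉ K ∙ x ⊔ K ∙ z)
    (hv : v ⬝ᵥ z = 0) :
    ∃ v₁ v₂, v₁ + v₂ = v ∧ v₁ ⬝ᵥ x = 0 ∧ v₁ ⬝ᵥ z = 0 ∧ v₂ ⬝ᵥ x' = 0 ∧ v₂ ⬝ᵥ z = 0 := by
  obtain ⟨u, hux, huz, hux'⟩ : ∃ u, u ⬝ᵥ x = 0 ∧ u ⬝ᵥ z = 0 ∧ u ⬝ᵥ x' ≠ 0 := by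
    by_contra! h
    obtain ⟨α, β, rfl⟩ := eq_smul_add_smul_of_dotProduct h
    exact hx' (Submodule.add_mem_sup
      (Submodule.smul_mem _ _ (Submodule.mem_span_singleton_self x))
      (Submodule.smul_mem _ _ (Submodule.mem_span_singleton_self z)))
  refine ⟨((v ⬝ᵥ x') / (u ⬝ᵥ x')) • u, v - ((v ⬝ᵥ x') / (u ⬝ᵥ x')) • u, by abel, ?_, ?_, ?_, ?_⟩
  · rw [smul_dotProduct, hux, smul_zero]
  · rw [smul_dotProduct, huz, smul_zero]
  · rw [sub_dotProduct, smul_dotProduct, smul_eq_mul, div_mul_cancel₀ _ hux', sub_self]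
  · rw [sub_dotProduct, smul_dotProduct, huz, smul_zero, hv, sub_zero]

theorem RangeCompatible.map_smul_dotProduct (hSA : S ≤ altMatrices n K)
    (hS : codimIn S (altMatrices n K) + 3 ≤ n)
    {F : S →+ (Fin n → K)} (hF : RangeCompatible F) {z : Fin n → K} (hz : Ordinary S z)
    (c : K) (M : S) : F (c • M) ⬝ᵥ z = c * (F M ⬝ᵥ z) := by
  obtain ⟨x, hxz⟩ := hz.exists_pair hSA hS
  -- With one partner x, homogeneity is known only for matrices killing x. A second partner outside
  -- the span of x and z lets Mz be split into two values, each attained by a matrix killing x or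
  -- x'.
  obtain ⟨x', hx'z, hx'⟩ : ∃ x', OrdinaryPair S x' z ∧ x' ∉ K ∙ x ⊔ K ∙ z := by
    by_contra! h
    have h1 := eq_top_of_ordinaryPair_mem hSA hS hz
      ((le_sup_right : K ∙ z ≤ K ∙ x ⊔ K ∙ z) (Submodule.mem_span_singleton_self z)) h
    have h2 := Submodule.finrank_add_le_finrank_add_finrank (K ∙ x) (K ∙ z)
    have h3 := finrank_span_singleton (K := K) (hz.ne_zero (by omega))
    have h4 := finrank_span_le_card (R := K) ({x} : Set (Fin n → K))
    rw [h1, finrank_top, Module.finrank_fin_fun, h3] at h2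
    simp only [Set.toFinset_singleton, Finset.card_singleton] at h4
    omega
  have hMz : (M : Matrix (Fin n) (Fin n) K) *ᵥ z ⬝ᵥ z = 0 := by
    rw [dotProduct_comm, hSA M.2 z]
  obtain ⟨v₁, v₂, hv, h1x, h1z, h2x, h2z⟩ := exists_add_eq_of_dotProduct hx' hMz
  obtain ⟨M₁, hM₁, hM₁x, hM₁z⟩ := hxz 0 v₁ (zero_dotProduct x) h1z
    (by rw [h1x, zero_dotProduct, add_zero])
  obtain ⟨M₂, hM₂, hM₂x, hM₂z⟩ := hx'z 0 v₂ (zero_dotProduct x') h2z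
    (by rw [h2x, zero_dotProduct, add_zero])
  have h1 := hF.map_smul_dotProduct_of_pair hSA hxz c (M := ⟨M₁, hM₁⟩) hM₁x
  have h2 := hF.map_smul_dotProduct_of_pair hSA hx'z c (M := ⟨M₂, hM₂⟩) hM₂x
  have hz0 : (M : Matrix (Fin n) (Fin n) K) *ᵥ z =
      ((⟨M₁, hM₁⟩ + ⟨M₂, hM₂⟩ : S) : Matrix (Fin n) (Fin n) K) *ᵥ z := by
    rw [Submodule.coe_add, add_mulVec, hM₁z, hM₂z, hv]
  have h3 := hF.dotProduct_eq hSA hz0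
  have h4 := hF.dotProduct_eq hSA (M := c • M) (N := c • (⟨M₁, hM₁⟩ + ⟨M₂, hM₂⟩)) (x := z)
    (by rw [Submodule.coe_smul, Submodule.coe_smul, smul_mulVec, smul_mulVec, hz0])
  rw [h3, h4, smul_add, map_add, map_add, add_dotProduct, add_dotProduct, h1, h2, mul_add]

/-- Range-compatible homomorphisms on spaces of small codimension are linear. -/
theorem RangeCompatible.map_smul (hSA : S ≤ altMatrices n K)
    (hS : codimIn S (altMatrices n K) + 3 ≤ n)
    {F : S →+ (Fin n → K)} (hF : RangeCompatible F) (c : K) (M : S) : F (c • M) = c • F M := by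
  obtain ⟨z, hz⟩ := exists_ordinary hS
  let W : Submodule K (Fin n → K) := LinearMap.ker (dotProductEquiv K (Fin n) (F (c • M) - c • F M))
  have hW : ∀ y, y ∈ W ↔ F (c • M) ⬝ᵥ y = c * (F M ⬝ᵥ y) := fun y => by
    rw [LinearMap.mem_ker, dotProductEquiv_apply_apply, sub_dotProduct, sub_eq_zero,
      smul_dotProduct, smul_eq_mul]
  have htop : W = ⊤ := eq_top_of_ordinaryPair_mem hSA hS hz
    ((hW z).2 (hF.map_smul_dotProduct hSA hS hz c M))
    (fun x hx => (hW x).2 (hF.map_smul_dotProduct hSA hS (hx.left (by omega)) c M))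
  refine _root_.dotProduct_eq _ _ fun y => ?_
  rw [smul_dotProduct, smul_eq_mul]
  exact (hW y).1 (htop ▸ Submodule.mem_top)

/-- The linear form M ↦ F(M)·z vanishes whenever Mz = 0, so it factors through M ↦ Mz. -/
theorem RangeCompatible.exists_dotProduct_eq (hSA : S ≤ altMatrices n K)
    {F : S →ₗ[K] (Fin n → K)} (hF : RangeCompatible F) (z : Fin n → K) :
    ∃ u, ∀ M : S, F M ⬝ᵥ z = u ⬝ᵥ ((M : Matrix (Fin n) (Fin n) K) *ᵥ z) := by
  let φ : Module.Dual K S := (dotProductEquiv K (Fin n) z).comp F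
  have hφ : φ ∈ LinearMap.range ((mulVecAt z).comp S.subtype).dualMap := by
    rw [LinearMap.range_dualMap_eq_dualAnnihilator_ker, Submodule.mem_dualAnnihilator]
    intro M hM
    have := hF.dotProduct_eq_zero hSA (M := M) (x := z) hM
    rw [dotProduct_comm] at this
    exact this
  obtain ⟨ψ, hψ⟩ := hφ
  obtain ⟨u, hu⟩ := _root_.exists_dotProduct_eq ψ
  refine ⟨u, fun M => ?_⟩
  rw [dotProduct_comm, ← hu]
  exact (LinearMap.congr_fun hψ M).symm

theorem RangeCompatible.exists_eq_smul_add_smul (hSA : S ≤ altMatrices n K)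
    {F : S →ₗ[K] (Fin n → K)} (hF : RangeCompatible F) {x z u u' : Fin n → K}
    (hxz : OrdinaryPair S x z)
    (hu : ∀ M : S, F M ⬝ᵥ z = u ⬝ᵥ ((M : Matrix (Fin n) (Fin n) K) *ᵥ z))
    (hu' : ∀ M : S, F M ⬝ᵥ x = u' ⬝ᵥ ((M : Matrix (Fin n) (Fin n) K) *ᵥ x)) :
    ∃ α β : K, u' - u = α • x + β • z := by
  refine eq_smul_add_smul_of_dotProduct fun v hvx hvz => ?_
  obtain ⟨M, hM, hMx, hMz⟩ := hxz 0 v (zero_dotProduct x) hvz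
    (by rw [hvx, zero_dotProduct, add_zero])
  obtain ⟨N, hN, hNx, hNz⟩ := hxz v 0 hvx (zero_dotProduct z)
    (by rw [hvz, zero_dotProduct, add_zero])
  have h := RangeCompatible.dotProduct_smul_eq hSA (F := F.toAddMonoidHom) hF (M := ⟨M, hM⟩)
    (N := ⟨N, hN⟩) 1 hMx hNz (hMz.trans hNx.symm)
  rw [one_smul, one_mul] at h
  have h1 := hu ⟨M, hM⟩
  have h2 := hu' ⟨N, hN⟩
  simp only at h1 h2
  rw [hMz] at h1
  rw [hNx] at h2
  rw [dotProduct_sub, sub_eq_zero, dotProduct_comm v u', dotProduct_comm v u, ← h1, ← h2]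
  exact h.symm

/-- The vectors `y` for which `F M ⬝ y` depends linearly on `M z`. -/
def proportionalAt (F : S →ₗ[K] (Fin n → K)) (z : Fin n → K) : Submodule K (Fin n → K) where
  carrier := {y | ∃ t : Fin n → K, ∀ M : S,
    F M ⬝ᵥ y = t ⬝ᵥ ((M : Matrix (Fin n) (Fin n) K) *ᵥ z)}
  add_mem' := by
    rintro y y' ⟨t, ht⟩ ⟨t', ht'⟩
    exact ⟨t + t', fun M => by rw [dotProduct_add, ht, ht', add_dotProduct]⟩
  zero_mem' := ⟨0, fun M => by rw [dotProduct_zero, zero_dotProduct]⟩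
  smul_mem' := by
    rintro c y ⟨t, ht⟩
    exact ⟨c • t, fun M => by rw [dotProduct_smul, ht, smul_dotProduct]⟩

theorem RangeCompatible.exists_dotProduct_eq_smul (hSA : S ≤ altMatrices n K)
    {F : S →ₗ[K] (Fin n → K)} (hF : RangeCompatible F) {y z : Fin n → K}
    (hyz : OrdinaryPair S y z) (hFz : ∀ M, F M ⬝ᵥ z = 0) :
    ∃ c : K, ∀ M : S, F M ⬝ᵥ y = (c • y) ⬝ᵥ ((M : Matrix (Fin n) (Fin n) K) *ᵥ z) := by
  obtain ⟨u, hu⟩ := hF.exists_dotProduct_eq hSA y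
  obtain ⟨α, β, h⟩ := hF.exists_eq_smul_add_smul hSA hyz (u := 0)
    (fun M => by rw [hFz, zero_dotProduct]) hu
  rw [sub_zero] at h
  refine ⟨-β, fun M => ?_⟩
  rw [hu, h, add_dotProduct, smul_dotProduct, smul_dotProduct, hSA M.2 y,
    dotProduct_mulVec_swap (hSA M.2) z y, smul_zero, zero_add, smul_dotProduct, neg_smul, smul_neg]

theorem RangeCompatible.proportionalAt_eq_top (hSA : S ≤ altMatrices n K)
    (hS : codimIn S (altMatrices n K) + 3 ≤ n) {F : S →ₗ[K] (Fin n → K)}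
    (hF : RangeCompatible F) {z : Fin n → K} (hz : Ordinary S z) (hFz : ∀ M, F M ⬝ᵥ z = 0) :
    proportionalAt F z = ⊤ := by
  refine eq_top_of_ordinaryPair_mem hSA hS hz ⟨0, fun M => by rw [hFz, zero_dotProduct]⟩
    fun y hy => ?_
  obtain ⟨c, hc⟩ := hF.exists_dotProduct_eq_smul hSA hy hFz
  exact ⟨c • y, hc⟩

theorem RangeCompatible.eq_zero_of_pair (hSA : S ≤ altMatrices n K)
    (hS : codimIn S (altMatrices n K) + 3 ≤ n) {F : S →ₗ[K] (Fin n → K)}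
    (hF : RangeCompatible F) {x z : Fin n → K} (hxz : OrdinaryPair S x z)
    (hFx : ∀ M, F M ⬝ᵥ x = 0) (hFz : ∀ M, F M ⬝ᵥ z = 0) (M : S) : F M = 0 := by
  have hn : 2 ≤ n := by omega
  have hx := hxz.left hn
  have hz := hxz.symm.left hn
  have hrep : ∀ y, ∃ τ : K, ∀ M : S,
      F M ⬝ᵥ y = (τ • x) ⬝ᵥ ((M : Matrix (Fin n) (Fin n) K) *ᵥ z) := by
    intro y
    obtain ⟨t, ht⟩ : y ∈ proportionalAt F z :=
      hF.proportionalAt_eq_top hSA hS hz hFz ▸ Submodule.mem_top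
    obtain ⟨t', ht'⟩ : y ∈ proportionalAt F x :=
      hF.proportionalAt_eq_top hSA hS hx hFx ▸ Submodule.mem_top
    -- The identity t·Mz = t'·Mx, tested on matrices with Mx = 0, forces t into the span of x and z;
    -- its z part is then irrelevant because z·Mz = 0.
    obtain ⟨α, β, rfl⟩ := eq_smul_add_smul_of_dotProduct (x := x) (z := z) (t := t)
      fun v hvx hvz => by
        obtain ⟨N, hN, hNx, hNz⟩ := hxz 0 v (zero_dotProduct x) hvz
          (by rw [hvx, zero_dotProduct, add_zero])
        have h1 := ht ⟨N, hN⟩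
        have h2 := ht' ⟨N, hN⟩
        simp only at h1 h2
        rw [dotProduct_comm, ← hNz, ← h1, h2, hNx, dotProduct_zero]
    refine ⟨α, fun M => ?_⟩
    rw [ht, add_dotProduct, smul_dotProduct β, hSA M.2 z, smul_zero, add_zero]
  let W : Submodule K (Fin n → K) :=
    ⨅ M, LinearMap.ker (dotProductEquiv K (Fin n) (F M))
  have hW : ∀ y, y ∈ W ↔ ∀ M, F M ⬝ᵥ y = 0 := fun y => by
    simp only [W, Submodule.mem_iInf, LinearMap.mem_ker, dotProductEquiv_apply_apply]
  have htop : W = ⊤ := by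
    refine eq_top_of_ordinaryPair_mem hSA hS hz ((hW z).2 hFz) fun y hy => ?_
    by_cases hmem : y ∈ K ∙ x ⊔ K ∙ z
    · exact sup_le ((Submodule.span_singleton_le_iff_mem _ _).2 ((hW x).2 hFx))
        ((Submodule.span_singleton_le_iff_mem _ _).2 ((hW z).2 hFz)) hmem
    obtain ⟨τ, hτ⟩ := hrep y
    obtain ⟨c, hc⟩ := hF.exists_dotProduct_eq_smul hSA hy hFz
    -- F(M)·y equals both cy·Mz and τx·Mz. Since z is ordinary, cy - τx lies in Kz, so c = 0 when y
    -- is outside the span of x and z.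
    obtain ⟨α, β, h⟩ := eq_smul_add_smul_of_dotProduct (x := z) (z := z) (t := c • y - τ • x)
      fun v hvz _ => by
        obtain ⟨N, hN, hNz⟩ := hz v hvz
        have h1 := hc ⟨N, hN⟩
        rw [hτ ⟨N, hN⟩] at h1
        simp only at h1
        rw [dotProduct_comm, ← hNz, sub_dotProduct, h1, sub_self]
    have hc0 : c = 0 := by
      by_contra hc0
      refine hmem ((Submodule.smul_mem_iff _ hc0).1 ?_)
      rw [sub_eq_iff_eq_add.1 h, ← add_smul, add_comm]
      exact Submodule.add_mem_sup
        (Submodule.smul_mem _ _ (Submodule.mem_span_singleton_self x))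
        (Submodule.smul_mem _ _ (Submodule.mem_span_singleton_self z))
    exact (hW y).2 fun M => by rw [hc, hc0, zero_smul, zero_dotProduct]
  refine _root_.dotProduct_eq_zero _ fun y => ?_
  exact (hW y).1 (htop ▸ Submodule.mem_top) M

theorem RangeCompatible.localMap (hSA : S ≤ altMatrices n K)
    (hS : codimIn S (altMatrices n K) + 3 ≤ n)
    {F : S →+ (Fin n → K)} (hF : RangeCompatible F) : LocalMap F := by
  let G : S →ₗ[K] (Fin n → K) := { F with map_smul' := fun c M => hF.map_smul hSA hS c M }
  have hG : RangeCompatible G := hF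
  obtain ⟨z, hz⟩ := exists_ordinary hS
  obtain ⟨x, hxz⟩ := hz.exists_pair hSA hS
  obtain ⟨u, hu⟩ := hG.exists_dotProduct_eq hSA z
  obtain ⟨u', hu'⟩ := hG.exists_dotProduct_eq hSA x
  obtain ⟨α, β, h⟩ := hG.exists_eq_smul_add_smul hSA hxz hu hu'
  -- The vector u + βz = u' - αx represents F at both z and x, so adding its local map cancels F
  -- there; the sign comes from alternation.
  let H : S →ₗ[K] (Fin n → K) := G + (mulVecAt (u + β • z)).comp S.subtype
  have hH : ∀ M, H M = F M + (M : Matrix (Fin n) (Fin n) K) *ᵥ (u + β • z) := fun M => rfl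
  have hHR : RangeCompatible H := fun M =>
    Submodule.add_mem _ (hF M) ⟨u + β • z, rfl⟩
  have hHd : ∀ (M : S) y, H M ⬝ᵥ y =
      F M ⬝ᵥ y - (u + β • z) ⬝ᵥ ((M : Matrix (Fin n) (Fin n) K) *ᵥ y) := fun M y => by
    rw [hH, add_dotProduct, dotProduct_comm _ y, dotProduct_comm _ y,
      dotProduct_mulVec_swap (hSA M.2) y, sub_eq_add_neg]
  have hHz : ∀ M, H M ⬝ᵥ z = 0 := fun M => by
    rw [hHd, add_dotProduct, smul_dotProduct, hSA M.2 z, smul_zero, add_zero, sub_eq_zero]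
    exact hu M
  have hHx : ∀ M, H M ⬝ᵥ x = 0 := fun M => by
    have h' : u + β • z = u' - α • x := by rw [sub_eq_iff_eq_add.1 h]; abel
    rw [hHd, h', sub_dotProduct, smul_dotProduct, hSA M.2 x, smul_zero, sub_zero, sub_eq_zero]
    exact hu' M
  refine ⟨-(u + β • z), fun M => ?_⟩
  have := hHR.eq_zero_of_pair hSA hS hxz hHx hHz M
  rw [hH] at this
  rw [mulVec_neg]
  exact eq_neg_of_add_eq_zero_left this

end RangeCompatibleMaps

/-! ### A nonlocal example in codimension n - 2. -/

section Optimality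

variable {K : Type*} [Field K] {n : ℕ}

theorem apply_self_of_mem_altMatrices {M : Matrix (Fin n) (Fin n) K} (hM : M ∈ altMatrices n K)
    (i : Fin n) : M i i = 0 := by
  simpa using hM (Pi.single i 1)

theorem apply_swap_of_mem_altMatrices {M : Matrix (Fin n) (Fin n) K} (hM : M ∈ altMatrices n K)
    (i j : Fin n) : M i j = -M j i := by
  simpa using dotProduct_mulVec_swap hM (Pi.single i 1) (Pi.single j 1)

theorem single_sub_single_mem_altMatrices (i j : Fin n) (a : K) :
    Matrix.single i j a - Matrix.single j i a ∈ altMatrices n K := by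
  intro X
  have h : X ⬝ᵥ Pi.single i (a * X j) - X ⬝ᵥ Pi.single j (a * X i) = 0 := by
    rw [dotProduct_single, dotProduct_single]
    ring
  rw [Matrix.sub_mulVec, dotProduct_sub, Matrix.single_mulVec, Matrix.single_mulVec]
  exact h

/-- If `K` is not a prime field, it has an additive map that is not a homothety. -/
theorem exists_addMonoidHom_ne_mul (hK : (⊥ : Subfield K) ≠ ⊤) :
    ∃ f : K →+ K, ¬ ∃ c, ∀ a, f a = c * a := by
  obtain ⟨b, hb⟩ : ∃ b, b ∉ (⊥ : Subfield K) := by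
    by_contra! h
    exact hK (eq_top_iff.2 fun a _ => h a)
  let V : Submodule (⊥ : Subfield K) K := Submodule.span _ {1}
  have hbV : b ∉ V := by
    intro h
    obtain ⟨a, ha⟩ := Submodule.mem_span_singleton.1 h
    refine hb ?_
    rw [← ha, Subfield.smul_def, smul_eq_mul, mul_one]
    exact a.2
  obtain ⟨f, hf, hV⟩ := Submodule.exists_le_ker_of_notMem hbV
  -- A form over the prime subfield that kills 1 but not b: vanishing at 1 would make the homothety
  -- zero.
  refine ⟨(⊥ : Subfield K).subtype.toAddMonoidHom.comp f.toAddMonoidHom, ?_⟩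
  rintro ⟨c, hc⟩
  have h1 : f 1 = 0 := hV (Submodule.mem_span_singleton_self 1)
  have hc0 : c = 0 := by
    have := hc 1
    simpa [h1] using this.symm
  have hb0 := hc b
  rw [hc0, zero_mul] at hb0
  exact hf (Subtype.ext hb0)

theorem exists_nonlocal (hn : 2 ≤ n) (hK : (⊥ : Subfield K) ≠ ⊤) :
    ∃ S : Submodule K (Matrix (Fin n) (Fin n) K), S ≤ altMatrices n K ∧
      (codimIn S (altMatrices n K) : ℤ) = (n : ℤ) - 2 ∧
      ∃ F : S →+ (Fin n → K), RangeCompatible F ∧ ¬ LocalMap F := by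
  obtain ⟨m, rfl⟩ := Nat.exists_eq_add_of_le' hn
  let ρ : altMatrices (m + 2) K →ₗ[K] (Fin m → K) :=
    { toFun := fun M j => (M : Matrix (Fin (m + 2)) (Fin (m + 2)) K) 0 j.succ.succ
      map_add' := fun M N => rfl
      map_smul' := fun c M => rfl }
  have hρa : ∀ (M : altMatrices (m + 2) K) (j : Fin m),
      ρ M j = (M : Matrix (Fin (m + 2)) (Fin (m + 2)) K) 0 j.succ.succ := fun _ _ => rfl
  have hρ : Function.Surjective ρ := by
    intro v
    refine ⟨∑ j : Fin m, ⟨_, single_sub_single_mem_altMatrices 0 j.succ.succ (v j)⟩, ?_⟩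
    ext k
    rw [map_sum, Finset.sum_apply, Finset.sum_eq_single k]
    · simp [hρa, Fin.ext_iff]
    · intro j _ hjk
      have : (j : ℕ) ≠ k := fun h => hjk (Fin.ext h)
      simp [hρa, Fin.ext_iff, this]
    · simp
  let S := (LinearMap.ker ρ).map (altMatrices (m + 2) K).subtype
  have hSA : S ≤ altMatrices (m + 2) K := Submodule.map_subtype_le _ _
  have hS0 : ∀ M ∈ S, ∀ j : Fin m, M 0 j.succ.succ = 0 := by
    rintro _ ⟨M, hM, rfl⟩ j
    exact congrFun (LinearMap.mem_ker.1 hM) j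
  have hsub : S.submoduleOf (altMatrices (m + 2) K) = LinearMap.ker ρ :=
    Submodule.comap_map_eq_of_injective (Submodule.injective_subtype _) _
  refine ⟨S, hSA, ?_, ?_⟩
  · rw [codimIn, hsub, (ρ.quotKerEquivOfSurjective hρ).finrank_eq, Module.finrank_fin_fun]
    push_cast
    ring
  obtain ⟨f, hf⟩ := exists_addMonoidHom_ne_mul hK
  let F : S →+ (Fin (m + 2) → K) :=
    { toFun := fun M => Pi.single 1 (f ((M : Matrix (Fin (m + 2)) (Fin (m + 2)) K) 0 1))
      map_zero' := by simp
      map_add' := fun M N => by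
        rw [Submodule.coe_add, Matrix.add_apply, map_add, Pi.single_add] }
  have hF : ∀ M : S, F M = Pi.single 1 (f ((M : Matrix (Fin (m + 2)) (Fin (m + 2)) K) 0 1)) :=
    fun M => rfl
  refine ⟨F, fun M => ?_, ?_⟩
  · by_cases h0 : (M : Matrix (Fin (m + 2)) (Fin (m + 2)) K) 0 1 = 0
    · rw [hF, h0, map_zero, Pi.single_zero]
      exact Submodule.zero_mem _
    · rw [hF]
      -- Column 0 of M is -M₀₁ e₁, so this multiple of e₀ is mapped to f(M₀₁) e₁.
      refine ⟨Pi.single 0 (-(f ((M : Matrix (Fin (m + 2)) (Fin (m + 2)) K) 0 1) /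
        (M : Matrix (Fin (m + 2)) (Fin (m + 2)) K) 0 1)), ?_⟩
      ext i
      rw [mulVecLin_apply, mulVec_single]
      simp only [Pi.smul_apply, MulOpposite.smul_eq_mul_unop, MulOpposite.unop_op, col_apply]
      rw [apply_swap_of_mem_altMatrices (hSA M.2)]
      refine Fin.cases ?_ (fun i => Fin.cases ?_ (fun i => ?_) i) i
      · rw [apply_self_of_mem_altMatrices (hSA M.2)]
        simp
      · simp only [Fin.succ_zero_eq_one, Pi.single_eq_same, neg_mul_neg]
        rw [mul_div_cancel₀ _ h0]
      · rw [hS0 _ M.2 i]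
        simp [Fin.ext_iff]
  · rintro ⟨x, hx⟩
    refine hf ⟨-x 0, fun a => ?_⟩
    have hM : Matrix.single 0 1 a - Matrix.single 1 0 a ∈ S :=
      ⟨⟨_, single_sub_single_mem_altMatrices 0 1 a⟩, by
        rw [SetLike.mem_coe, LinearMap.mem_ker]
        ext j
        simp [hρa, Fin.ext_iff], rfl⟩
    have h1 := congrFun (hx ⟨_, hM⟩) 1
    rw [hF] at h1
    simp [Matrix.sub_mulVec, Matrix.single_mulVec] at h1
    rw [h1]
    ring

end Optimality

theorem mainTheorem2 {K : Type*} [Field K] (n : ℕ) :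
    (∀ S : Submodule K (Matrix (Fin n) (Fin n) K), S ≤ altMatrices n K →
      (codimIn S (altMatrices n K) : ℤ) ≤ (n : ℤ) - 3 →
      ∀ F : S →+ (Fin n → K), RangeCompatible F → LocalMap F) ∧
    (2 ≤ n → (⊥ : Subfield K) ≠ ⊤ →
      ∃ S : Submodule K (Matrix (Fin n) (Fin n) K), S ≤ altMatrices n K ∧
        (codimIn S (altMatrices n K) : ℤ) = (n : ℤ) - 2 ∧
        ∃ F : S →+ (Fin n → K), RangeCompatible F ∧ ¬ LocalMap F) :=
  ⟨fun _ hSA hS _ hF => hF.localMap hSA (by omega), fun hn hK => exists_nonlocal hn hK⟩
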